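/- Let $\mathbb{k}$ be a commutative unital ring, $A$ an associative unital $\mathbb{k}$-algebra, and $\Omega^\bullet_d=\bigoplus_{m\ge 0}\Omega^m_d$ an exterior algebra over $A$: a graded $\mathbb{k}$-algebra with $\Omega^0_d=A$ and product $\wedge$, equipped with a $\mathbb{k}$-linear differential $d$ of degree $1$ with $d^2=0$ and $d(\omega\wedge\eta)=d\omega\wedge\eta+(-1)^{\deg\omega}\omega\wedge d\eta$, and generated as an algebra by $A$ and $dA$. For a left $A$-module $N$ write $\Omega^m_dN=\Omega^m_d\otimes_AN$, and for $A$-linear $\varphi$ let $\Omega^m_d(\varphi)=\mathrm{id}\otimes_A\varphi$. Let $J^1_dA$ be the $A$-bimodule $(A\otimes_{\mathbb{k}}A)/\{\sum_i a_i\otimes b_i:\ \sum_i a_ib_i=0,\ \sum_i a_i\,db_i=0\}$, with left action on the first factor and right action on the second; put $J^1_dN=J^1_dA\otimes_AN$, $J^1_d(\varphi)=\mathrm{id}\otimes_A\varphi$, and $\pi^{1,0}_{d,N}:J^1_dN\to N$, $[a\otimes b]\otimes n\mapsto abn$. Let $(\Omega^1_d\ltimes\Omega^2_d)N$ be the group $\Omega^1_dN\oplus\Omega^2_dN$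 with the $A$-action $a\cdot(\alpha,\beta)=(a\alpha,\,da\wedge\alpha+a\beta)$, and let $\widetilde{\mathfrak D}_N=(\widetilde{\mathfrak D}^I_N,\widetilde{\mathfrak D}^{II}_N):J^1_dJ^1_dN\to(\Omega^1_d\ltimes\Omega^2_d)N$ be the $A$-linear map $$[a\otimes b]\otimes[c\otimes c']\otimes n\longmapsto\bigl(a\,d(bc)\,c'\otimes n,\ da\wedge d(bc)\,c'\otimes n\bigr).$$ The holonomic jet modules of a left $A$-module $E$ are $J^0_dE=E$, $J^1_dE=J^1_dA\otimes_AE$ with $l^{1,0}=\mathrm{id}$, and for $n\ge2$ $$J^n_dE=\ker\bigl(\widetilde{\mathfrak D}_{J^{n-2}_dE}\circ J^1_d(l^{1,n-2})\bigr)\subseteq J^1_dJ^{n-1}_dE$$ with inclusion $l^{1,n-1}:J^n_dE\hookrightarrow J^1_dJ^{n-1}_dE$. The jet projections are $\pi^{n,n-1}=\pi^{1,0}_{d,J^{n-1}_dE}\circ l^{1,n-1}:J^n_dE\to J^{n-1}_dE$. The Spencer operators are $$\mathcal S^{n,m}:\Omega^m_dJ^n_dE\to\Omega^{m+1}_dJ^{n-1}_dE,\qquad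 \omega\otimes\xi\mapsto\sum_jd(\omega y_j)z_j\otimes\xi_j\quad\text{for } l^{1,n-1}(\xi)=\sum_j[y_j\otimes z_j]\otimes\xi_j .$$ Let $n\ge1$, and let $C^n$ be an $n$-connection on $E$, i.e. an $A$-linear map $C^n:J^{n-1}_dE\to J^n_dE$ with $\pi^{n,n-1}\circ C^n=\mathrm{id}$. Its curvature is $$R_{C^n}=-\widetilde{\mathfrak D}^{II}_{J^{n-1}_dE}\circ J^1_d(l^{1,n-1})\circ J^1_d(C^n)\circ l^{1,n-1}\circ C^n:J^{n-1}_dE\to\Omega^2_dJ^{n-1}_dE,$$ its associated connection is $\nabla^{C^n}=\mathcal S^{n,0}\circ C^n:J^{n-1}_dE\to\Omega^1_dJ^{n-1}_dE$, and its exterior covariant derivative is $d_{C^n}=\mathcal S^{n,m}\circ\Omega^m_d(C^n):\Omega^m_dJ^{n-1}_dE\to\Omega^{m+1}_dJ^{n-1}_dE$ for $m\ge0$. **Proposition 4.14.** The curvature $R_{C^n}$ of $C^n$ coincides with the curvature $R_{\nabla^{C^n}}:=d_{C^n}\circ\nabla^{C^n}$ of its associated connection. More generally, for all $m\ge0$,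 $\omega\in\Omega^m_d$ and $\xi\in J^{n-1}_dE$, $$d_{C^n}\circ d_{C^n}(\omega\otimes_A\xi)=\omega\wedge R_{C^n}(\xi).$$ -/

import Mathlib

open scoped TensorProduct

universe u v w x

namespace NCJet

section TensorOverRing

/-! ### Tensor product over a (noncommutative) ring

For an `A`-bimodule `M` and a left `A`-module `N`, the left `A`-module `M ⊗_A N`. -/

/-- The subgroup of `M ⊗_ℤ N` generated by all `(m a) ⊗ n - m ⊗ (a n)`; it is stable under the
left action of `A` on `M`. -/
def balancedRel (A : Type u) [Ring A]
    (M : Type v) [AddCommGroup M] [Module A M] [Module Aᵐᵒᵖ M] [SMulCommClass A Aᵐᵒᵖ M]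
    (N : Type w) [AddCommGroup N] [Module A N] : Submodule A (M ⊗[ℤ] N) where
  __ := AddSubgroup.closure
    {t : M ⊗[ℤ] N | ∃ (m : M) (a : A) (n : N),
      t = (MulOpposite.op a • m) ⊗ₜ[ℤ] n - m ⊗ₜ[ℤ] (a • n)}
  smul_mem' := by
    intro c t ht
    change t ∈ AddSubgroup.closure _ at ht
    change c • t ∈ AddSubgroup.closure _
    induction ht using AddSubgroup.closure_induction with
    | mem t ht =>
      obtain ⟨m, a, n, rfl⟩ := ht
      refine AddSubgroup.subset_closure ⟨c • m, a, n, ?_⟩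
      rw [smul_sub, TensorProduct.smul_tmul', TensorProduct.smul_tmul', smul_comm]
    | zero => rw [smul_zero]; exact zero_mem _
    | add s t _ _ hs ht => rw [smul_add]; exact add_mem hs ht
    | neg t _ ht => rw [smul_neg]; exact neg_mem ht

/-- `M ⊗_A N`. -/
def Tensor (A : Type u) [Ring A]
    (M : Type v) [AddCommGroup M] [Module A M] [Module Aᵐᵒᵖ M] [SMulCommClass A Aᵐᵒᵖ M]
    (N : Type w) [AddCommGroup N] [Module A N] : Type (max v w) :=
  (M ⊗[ℤ] N) ⧸ balancedRel A M N

variable {A : Type u} [Ring A]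
variable {M : Type v} [AddCommGroup M] [Module A M] [Module Aᵐᵒᵖ M] [SMulCommClass A Aᵐᵒᵖ M]
variable {M' : Type*} [AddCommGroup M'] [Module A M'] [Module Aᵐᵒᵖ M'] [SMulCommClass A Aᵐᵒᵖ M']
variable {N : Type w} [AddCommGroup N] [Module A N]
variable {N' : Type*} [AddCommGroup N'] [Module A N']

noncomputable instance : AddCommGroup (Tensor A M N) :=
  inferInstanceAs (AddCommGroup ((M ⊗[ℤ] N) ⧸ balancedRel A M N))

noncomputable instance : Module A (Tensor A M N) :=
  inferInstanceAs (Module A ((M ⊗[ℤ] N) ⧸ balancedRel A M N))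

namespace Tensor

variable (A) in
/-- The class `m ⊗_A n`. -/
def tmul (m : M) (n : N) : Tensor A M N :=
  Submodule.Quotient.mk (m ⊗ₜ[ℤ] n)

theorem tmul_add (m : M) (n n' : N) : tmul A m (n + n') = tmul A m n + tmul A m n' :=
  congrArg Submodule.Quotient.mk (TensorProduct.tmul_add m n n')

theorem add_tmul (m m' : M) (n : N) : tmul A (m + m') n = tmul A m n + tmul A m' n :=
  congrArg Submodule.Quotient.mk (TensorProduct.add_tmul m m' n)

@[simp]
theorem tmul_zero (m : M) : tmul A m (0 : N) = 0 :=
  congrArg Submodule.Quotient.mk (TensorProduct.tmul_zero N m)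

@[simp]
theorem zero_tmul (n : N) : tmul A (0 : M) n = 0 :=
  congrArg Submodule.Quotient.mk (TensorProduct.zero_tmul M n)

theorem smul_tmul (a : A) (m : M) (n : N) : a • tmul A m n = tmul A (a • m) n := rfl

theorem op_smul_tmul (a : A) (m : M) (n : N) :
    tmul A (MulOpposite.op a • m) n = tmul A m (a • n) :=
  (Submodule.Quotient.eq _).2 (AddSubgroup.subset_closure ⟨m, a, n, rfl⟩)

@[elab_as_elim]
theorem induction_on {p : Tensor A M N → Prop} (t : Tensor A M N)
    (zero : p 0) (tmul : ∀ m n, p (tmul A m n)) (add : ∀ s t, p s → p t → p (s + t)) : p t := by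
  obtain ⟨t, rfl⟩ := Submodule.Quotient.mk_surjective _ t
  induction t using TensorProduct.induction_on with
  | zero => exact zero
  | tmul m n => exact tmul m n
  | add s t hs ht => exact add _ _ hs ht

/-- The universal property: a balanced biadditive map `M × N → G` induces `M ⊗_A N → G`. -/
noncomputable def lift {G : Type*} [AddCommGroup G] (f : M →+ N →+ G)
    (hf : ∀ (m : M) (a : A) (n : N), f (MulOpposite.op a • m) n = f m (a • n)) :
    Tensor A M N →+ G :=
  QuotientAddGroup.lift (balancedRel A M N).toAddSubgroup
    (TensorProduct.liftAddHom f (fun r m n => by simp))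
    (by
      intro t ht
      change t ∈ AddSubgroup.closure _ at ht
      induction ht using AddSubgroup.closure_induction with
      | mem t ht =>
        obtain ⟨m, a, n, rfl⟩ := ht
        simp [hf]
      | zero => exact zero_mem _
      | add s t _ _ hs ht => exact add_mem hs ht
      | neg t _ ht => exact neg_mem ht)

@[simp]
theorem lift_tmul {G : Type*} [AddCommGroup G] (f : M →+ N →+ G)
    (hf : ∀ (m : M) (a : A) (n : N), f (MulOpposite.op a • m) n = f m (a • n)) (m : M) (n : N) :
    lift f hf (tmul A m n) = f m n := rfl

/-- `m ⊗_A n` as a biadditive map. -/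
noncomputable def tmulHom : M →+ N →+ Tensor A M N :=
  AddMonoidHom.mk' (fun m => AddMonoidHom.mk' (fun n => tmul A m n) (tmul_add m))
    (fun m m' => by ext n; exact add_tmul m m' n)

variable (N) in
/-- `f ⊗_A id : M ⊗_A N → M' ⊗_A N` for a right `A`-linear map `f`. -/
noncomputable def mapLeft (f : M →ₗ[Aᵐᵒᵖ] M') : Tensor A M N →+ Tensor A M' N :=
  lift (tmulHom.comp f.toAddMonoidHom) (fun m a n => by
    change tmul A (f (MulOpposite.op a • m)) n = tmul A (f m) (a • n)
    rw [map_smul, op_smul_tmul])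

@[simp]
theorem mapLeft_tmul (f : M →ₗ[Aᵐᵒᵖ] M') (m : M) (n : N) :
    mapLeft N f (tmul A m n) = tmul A (f m) n := rfl

variable (M) in
/-- `id ⊗_A φ : M ⊗_A N → M ⊗_A N'` for a left `A`-linear map `φ`. -/
noncomputable def mapRight (φ : N →ₗ[A] N') : Tensor A M N →ₗ[A] Tensor A M N' where
  __ := lift (tmulHom.compr₂ (AddMonoidHom.id _) |>.compl₂ φ.toAddMonoidHom) (fun m a n => by
    change tmul A (MulOpposite.op a • m) (φ n) = tmul A m (φ (a • n))
    rw [map_smul, op_smul_tmul])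
  map_smul' a t := by
    induction t using induction_on with
    | zero => simp
    | tmul m n => rfl
    | add s t hs ht => simpa [smul_add] using congrArg₂ (· + ·) hs ht

@[simp]
theorem mapRight_tmul (φ : N →ₗ[A] N') (m : M) (n : N) :
    mapRight M φ (tmul A m n) = tmul A m (φ n) := rfl

end Tensor

end TensorOverRing

/-! ### Exterior algebras over `A` -/

/-- An exterior algebra `Ω^•` over the `k`-algebra `A`: a graded `k`-algebra `Ω` (with grading
`deg`) whose degree zero part is `A`, with a differential `d` of degree one which squares to zero
and satisfies the graded Leibniz rule, such that `Ω` is generated as an algebra by `A` and `dA`. -/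
structure ExteriorCalculus (k : Type x) (A : Type u) (Ω : Type w)
    [CommRing k] [Ring A] [Algebra k A] [Ring Ω] [Algebra k Ω] where
  /-- the homogeneous components -/
  deg : ℕ → Submodule k Ω
  isInternal : DirectSum.IsInternal deg
  mul_mem : ∀ {m p : ℕ} {ω η : Ω}, ω ∈ deg m → η ∈ deg p → ω * η ∈ deg (m + p)
  /-- the identification of `A` with the degree zero part -/
  ofBase : A →ₐ[k] Ω
  ofBase_injective : Function.Injective ofBase
  mem_deg_zero : ∀ ω : Ω, ω ∈ deg 0 ↔ ∃ a : A, ofBase a = ω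
  /-- the differential -/
  d : Ω →ₗ[k] Ω
  d_mem : ∀ {m : ℕ} {ω : Ω}, ω ∈ deg m → d ω ∈ deg (m + 1)
  d_d : ∀ ω : Ω, d (d ω) = 0
  leibniz : ∀ {m : ℕ} {ω : Ω} (η : Ω), ω ∈ deg m →
    d (ω * η) = d ω * η + (-1 : ℤ) ^ m • (ω * d η)
  generated : Algebra.adjoin k (Set.range ofBase ∪ Set.range (fun a => d (ofBase a))) = ⊤

namespace ExteriorCalculus

variable {k : Type x} {A : Type u} {Ω : Type w}
  [CommRing k] [Ring A] [Algebra k A] [Ring Ω] [Algebra k Ω]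
variable (X : ExteriorCalculus k A Ω)

theorem ofBase_mem (a : A) : X.ofBase a ∈ X.deg 0 := (X.mem_deg_zero _).2 ⟨a, rfl⟩

theorem d_ofBase_mul (a b : A) :
    X.d (X.ofBase (a * b)) = X.d (X.ofBase a) * X.ofBase b + X.ofBase a * X.d (X.ofBase b) := by
  rw [map_mul, X.leibniz _ (X.ofBase_mem a)]; simp

theorem d_one : X.d 1 = 0 := by
  have h := X.d_ofBase_mul 1 1
  simpa using h

/-- The `A`-bimodule `Ω^m` of `m`-forms. -/
def Form (m : ℕ) : Type w := X.deg m

namespace Form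

variable {X} {m p : ℕ}

instance : AddCommGroup (X.Form m) := inferInstanceAs (AddCommGroup (X.deg m))

/-- The underlying element of `Ω`. -/
def val : X.Form m →+ Ω := (X.deg m).subtype.toAddMonoidHom

theorem val_injective : Function.Injective (val : X.Form m →+ Ω) := Subtype.val_injective

@[ext]
theorem ext {ω η : X.Form m} (h : ω.val = η.val) : ω = η := val_injective h

theorem val_mem (ω : X.Form m) : ω.val ∈ X.deg m := ω.2

/-- An `m`-form from a homogeneous element of degree `m`. -/
def mk (ω : Ω) (h : ω ∈ X.deg m) : X.Form m := ⟨ω, h⟩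

@[simp]
theorem val_mk (ω : Ω) (h : ω ∈ X.deg m) : (mk ω h : X.Form m).val = ω := rfl

instance : SMul A (X.Form m) :=
  ⟨fun a ω => mk (X.ofBase a * ω.val) (by simpa using X.mul_mem (X.ofBase_mem a) ω.val_mem)⟩

instance : SMul Aᵐᵒᵖ (X.Form m) :=
  ⟨fun a ω => mk (ω.val * X.ofBase a.unop) (X.mul_mem ω.val_mem (X.ofBase_mem a.unop))⟩

@[simp]
theorem val_smul (a : A) (ω : X.Form m) : (a • ω).val = X.ofBase a * ω.val := rfl

@[simp]
theorem val_op_smul (a : Aᵐᵒᵖ) (ω : X.Form m) : (a • ω).val = ω.val * X.ofBase a.unop := rfl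

instance : Module A (X.Form m) where
  one_smul ω := by ext; simp
  mul_smul a b ω := by ext; simp [mul_assoc]
  smul_zero a := by ext; simp
  smul_add a ω η := by ext; simp [mul_add]
  add_smul a b ω := by ext; simp [add_mul]
  zero_smul ω := by ext; simp

instance : Module Aᵐᵒᵖ (X.Form m) where
  one_smul ω := by ext; simp
  mul_smul a b ω := by ext; simp [mul_assoc]
  smul_zero a := by ext; simp
  smul_add a ω η := by ext; simp [add_mul]
  add_smul a b ω := by ext; simp [mul_add]
  zero_smul ω := by ext; simp

instance : SMulCommClass A Aᵐᵒᵖ (X.Form m) where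
  smul_comm a b ω := by ext; simp [mul_assoc]

/-- The unit `1 ∈ A = Ω^0`. -/
instance : One (X.Form 0) := ⟨mk 1 (by simpa using X.ofBase_mem 1)⟩

@[simp]
theorem val_one : (1 : X.Form 0).val = 1 := rfl

/-- `d : Ω^m → Ω^(m+1)`. -/
def diff (m : ℕ) : X.Form m →+ X.Form (m + 1) :=
  AddMonoidHom.mk' (fun ω => mk (X.d ω.val) (X.d_mem ω.val_mem)) (fun ω η => by ext; simp)

@[simp]
theorem val_diff (ω : X.Form m) : (diff m ω).val = X.d ω.val := rfl

variable (X) in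
/-- `d : A → Ω^1`. -/
def diffBase : A →+ X.Form 1 :=
  AddMonoidHom.mk' (fun a => mk (X.d (X.ofBase a)) (X.d_mem (X.ofBase_mem a)))
    (fun a b => by ext; simp)

@[simp]
theorem val_diffBase (a : A) : (diffBase X a).val = X.d (X.ofBase a) := rfl

/-- `η ↦ ω ∧ η`, a right `A`-linear map `Ω^p → Ω^(m+p)`. -/
def wedge (ω : X.Form m) : X.Form p →ₗ[Aᵐᵒᵖ] X.Form (m + p) where
  toFun η := mk (ω.val * η.val) (X.mul_mem ω.val_mem η.val_mem)
  map_add' η θ := by ext; simp [mul_add]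
  map_smul' a η := by ext; simp [mul_assoc]

@[simp]
theorem val_wedge (ω : X.Form m) (η : X.Form p) : (ω.wedge η).val = ω.val * η.val := rfl

end Form

variable (N : Type v) [AddCommGroup N] [Module A N]

/-- `Ω^m N = Ω^m ⊗_A N`. -/
abbrev FormT (m : ℕ) : Type (max w v) := Tensor A (X.Form m) N

variable {X N} in
/-- `η ⊗ n ↦ (ω ∧ η) ⊗ n`, as a map `Ω^p N → Ω^(m+p) N`. -/
noncomputable def wedgeT {m p : ℕ} (ω : X.Form m) : X.FormT N p →+ X.FormT N (m + p) :=
  Tensor.mapLeft N ω.wedge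

theorem wedgeT_tmul {m p : ℕ} (ω : X.Form m) (η : X.Form p) (n : N) :
    wedgeT ω (Tensor.tmul A η n) = Tensor.tmul A (ω.wedge η) n := rfl

/-! ### The first jet functor -/

/-- `A ⊗_k A → Ω^1`, `a ⊗ b ↦ a (d b)`. -/
noncomputable def univMap : A ⊗[k] A →ₗ[k] Ω :=
  TensorProduct.lift
    ((LinearMap.mul k Ω).compl₁₂ X.ofBase.toLinearMap (X.d ∘ₗ X.ofBase.toLinearMap))

@[simp]
theorem univMap_tmul (a b : A) : X.univMap (a ⊗ₜ b) = X.ofBase a * X.d (X.ofBase b) := rfl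

theorem univMap_smul (c : A) (t : A ⊗[k] A) : X.univMap (c • t) = X.ofBase c * X.univMap t := by
  induction t using TensorProduct.induction_on with
  | zero => simp
  | tmul a b => simp [TensorProduct.smul_tmul', mul_assoc]
  | add s t hs ht => simp [smul_add, mul_add, hs, ht]

theorem mul'_smul (c : A) (t : A ⊗[k] A) :
    LinearMap.mul' k A (c • t) = c * LinearMap.mul' k A t := by
  induction t using TensorProduct.induction_on with
  | zero => simp
  | tmul a b => simp [TensorProduct.smul_tmul', mul_assoc]
  | add s t hs ht => simp [smul_add, mul_add, hs, ht]

/-- The kernel `N_d^1` of the map from universal one-forms (the kernel of the multiplication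
`A ⊗_k A → A`) to `Ω^1`; i.e. all `∑ a_i ⊗ b_i` with `∑ a_i b_i = 0` and `∑ a_i (d b_i) = 0`. -/
def N1 : Submodule A (A ⊗[k] A) where
  carrier := {t | LinearMap.mul' k A t = 0 ∧ X.univMap t = 0}
  add_mem' hs ht := ⟨by rw [map_add, hs.1, ht.1, add_zero], by rw [map_add, hs.2, ht.2, add_zero]⟩
  zero_mem' := ⟨map_zero _, map_zero _⟩
  smul_mem' c t ht := ⟨by rw [mul'_smul, ht.1, mul_zero], by rw [univMap_smul, ht.2, mul_zero]⟩

/-- The `A`-bimodule `J^1 A = (A ⊗_k A) / N_d^1`. -/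
def J1A : Type u := (A ⊗[k] A) ⧸ X.N1

namespace J1A

noncomputable instance : AddCommGroup X.J1A := inferInstanceAs (AddCommGroup ((A ⊗[k] A) ⧸ X.N1))

/-- The left action `c [a ⊗ b] = [c a ⊗ b]`. -/
noncomputable instance : Module A X.J1A := inferInstanceAs (Module A ((A ⊗[k] A) ⧸ X.N1))

variable (k) in
/-- `a ⊗ b ↦ a ⊗ b c` on `A ⊗_k A`. -/
noncomputable def rightMul (c : A) : A ⊗[k] A →ₗ[A] A ⊗[k] A :=
  TensorProduct.AlgebraTensorModule.map LinearMap.id (LinearMap.mulRight k c)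

theorem rightMul_tmul (c a b : A) : rightMul k c (a ⊗ₜ[k] b) = a ⊗ₜ[k] (b * c) := rfl

theorem mul'_rightMul (c : A) (t : A ⊗[k] A) :
    LinearMap.mul' k A (rightMul k c t) = LinearMap.mul' k A t * c := by
  induction t using TensorProduct.induction_on with
  | zero => simp
  | tmul a b => simp [rightMul_tmul, mul_assoc]
  | add s t hs ht => simp [add_mul, hs, ht]

theorem univMap_rightMul (c : A) (t : A ⊗[k] A) :
    X.univMap (rightMul k c t) =
      X.univMap t * X.ofBase c + X.ofBase (LinearMap.mul' k A t) * X.d (X.ofBase c) := by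
  induction t using TensorProduct.induction_on with
  | zero => simp
  | tmul a b =>
    rw [rightMul_tmul, univMap_tmul, univMap_tmul, d_ofBase_mul, LinearMap.mul'_apply, map_mul,
      mul_add, mul_assoc, mul_assoc]
  | add s t hs ht =>
    simp only [map_add, hs, ht]
    noncomm_ring

/-- Right multiplication by `c` on `J^1 A`. -/
noncomputable def rightAct (c : A) : X.J1A →ₗ[A] X.J1A :=
  Submodule.mapQ X.N1 X.N1 (rightMul k c) (fun t ht =>
    ⟨by rw [mul'_rightMul, ht.1, zero_mul], by rw [univMap_rightMul, ht.1, ht.2]; simp⟩)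

/-- The class `[a ⊗ b]`. -/
def cls (a b : A) : X.J1A := Submodule.Quotient.mk (a ⊗ₜ[k] b)

variable {X} in
@[elab_as_elim]
theorem induction_on {p : X.J1A → Prop} (t : X.J1A)
    (zero : p 0) (cls : ∀ a b, p (cls X a b)) (add : ∀ s t, p s → p t → p (s + t)) : p t := by
  obtain ⟨t, rfl⟩ := Submodule.Quotient.mk_surjective _ t
  induction t using TensorProduct.induction_on with
  | zero => exact zero
  | tmul a b => exact cls a b
  | add s t hs ht => exact add _ _ hs ht

/-- The right action `[a ⊗ b] c = [a ⊗ b c]`. -/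
noncomputable instance : SMul Aᵐᵒᵖ X.J1A := ⟨fun c t => rightAct X c.unop t⟩

theorem op_smul_def (c : Aᵐᵒᵖ) (t : X.J1A) : c • t = rightAct X c.unop t := rfl

theorem op_smul_cls (c : Aᵐᵒᵖ) (a b : A) : c • cls X a b = cls X a (b * c.unop) := rfl

theorem smul_cls (c a b : A) : c • cls X a b = cls X (c * a) b := rfl

theorem cls_add (a b b' : A) : cls X a (b + b') = cls X a b + cls X a b' :=
  congrArg Submodule.Quotient.mk (TensorProduct.tmul_add a b b')

theorem cls_zero (a : A) : cls X a 0 = 0 :=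
  congrArg Submodule.Quotient.mk (TensorProduct.tmul_zero A a)

noncomputable instance : Module Aᵐᵒᵖ X.J1A where
  one_smul t := by
    induction t using induction_on with
    | zero => exact map_zero _
    | cls a b => simp [op_smul_cls]
    | add s t hs ht => simpa [op_smul_def] using congrArg₂ (· + ·) hs ht
  mul_smul c e t := by
    induction t using induction_on with
    | zero => simp [op_smul_def]
    | cls a b => simp [op_smul_cls, mul_assoc]
    | add s t hs ht => simpa [op_smul_def] using congrArg₂ (· + ·) hs ht
  smul_zero c := map_zero _
  smul_add c := map_add _
  add_smul c e t := by
    induction t using induction_on with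
    | zero => simp [op_smul_def]
    | cls a b => simp [op_smul_cls, mul_add, cls_add]
    | add s t hs ht =>
      simp only [op_smul_def, map_add] at hs ht ⊢
      rw [hs, ht]; abel
  zero_smul t := by
    induction t using induction_on with
    | zero => simp [op_smul_def]
    | cls a b => simp [op_smul_cls, cls_zero]
    | add s t hs ht => simpa [op_smul_def] using congrArg₂ (· + ·) hs ht

instance : SMulCommClass A Aᵐᵒᵖ X.J1A where
  smul_comm a c t := (map_smul (rightAct X c.unop) a t).symm

/-- Additive maps out of `J^1 A`: an additive map out of `A ⊗_k A` which vanishes on `N_d^1`. -/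
noncomputable def lift {G : Type*} [AddCommGroup G] (f : A ⊗[k] A →+ G)
    (hf : ∀ t, LinearMap.mul' k A t = 0 → X.univMap t = 0 → f t = 0) : X.J1A →+ G :=
  QuotientAddGroup.lift X.N1.toAddSubgroup f (fun t ht => hf t ht.1 ht.2)

@[simp]
theorem lift_cls {G : Type*} [AddCommGroup G] (f : A ⊗[k] A →+ G)
    (hf : ∀ t, LinearMap.mul' k A t = 0 → X.univMap t = 0 → f t = 0) (a b : A) :
    lift X f hf (cls X a b) = f (a ⊗ₜ b) := rfl

end J1A

/-- The first jet functor on objects: `J^1 N = J^1 A ⊗_A N`. -/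
abbrev J1 : Type (max u v) := Tensor A X.J1A N

variable {N} in
/-- The first jet functor on morphisms. -/
noncomputable def J1map {N' : Type*} [AddCommGroup N'] [Module A N'] (φ : N →ₗ[A] N') :
    X.J1 N →ₗ[A] X.J1 N' :=
  Tensor.mapRight X.J1A φ

/-- `J^1 A → A`, `[a ⊗ b] ↦ a b`. -/
noncomputable def J1Aproj : X.J1A →+ A :=
  J1A.lift X (LinearMap.mul' k A).toAddMonoidHom (fun _ h _ => h)

@[simp]
theorem J1Aproj_cls (a b : A) : X.J1Aproj (J1A.cls X a b) = a * b := rfl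

theorem J1Aproj_op_smul (t : X.J1A) (c : A) :
    X.J1Aproj (MulOpposite.op c • t) = X.J1Aproj t * c := by
  induction t using J1A.induction_on with
  | zero => simp
  | cls a b => simp [J1A.op_smul_cls, mul_assoc]
  | add s t hs ht => simp [add_mul, hs, ht]

theorem J1Aproj_smul (t : X.J1A) (c : A) : X.J1Aproj (c • t) = c * X.J1Aproj t := by
  induction t using J1A.induction_on with
  | zero => simp
  | cls a b => simp [J1A.smul_cls, mul_assoc]
  | add s t hs ht => simp [mul_add, hs, ht]

/-- The jet projection `π^{1,0} : J^1 N → N`, `[a ⊗ b] ⊗ n ↦ a b n`. -/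
noncomputable def proj10 : X.J1 N →ₗ[A] N where
  __ := Tensor.lift
    ((AddMonoidHom.mk' (fun t : X.J1A => DistribSMul.toAddMonoidHom N (X.J1Aproj t))
      (fun s t => by ext n; simp [add_smul])))
    (fun t c n => by
      change X.J1Aproj (MulOpposite.op c • t) • n = X.J1Aproj t • c • n
      rw [J1Aproj_op_smul, mul_smul])
  map_smul' c t := by
    induction t using Tensor.induction_on with
    | zero => simp
    | tmul t n =>
      change X.J1Aproj (c • t) • n = c • X.J1Aproj t • n
      rw [J1Aproj_smul, mul_smul]
    | add s t hs ht => simpa [smul_add] using congrArg₂ (· + ·) hs ht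

theorem proj10_cls (a b : A) (n : N) :
    X.proj10 N (Tensor.tmul A (J1A.cls X a b) n) = (a * b) • n := rfl

/-! ### The first Spencer operators -/

/-- For an `m`-form `ω`, the map `A ⊗_k A → Ω^(m+1)`, `y ⊗ z ↦ d(ω y) z`. -/
noncomputable def spencerPre {m : ℕ} (ω : X.Form m) : A ⊗[k] A →+ X.Form (m + 1) :=
  TensorProduct.liftAddHom
    (AddMonoidHom.mk' (fun y => AddMonoidHom.mk'
        (fun z => MulOpposite.op z • Form.diff m (MulOpposite.op y • ω))
        (fun z z' => by ext; simp [mul_add]))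
      (fun y y' => by ext z; simp [mul_add, add_mul]))
    (fun r y z => by ext; simp)

theorem val_spencerPre_tmul {m : ℕ} (ω : X.Form m) (y z : A) :
    (X.spencerPre ω (y ⊗ₜ z)).val = X.d (ω.val * X.ofBase y) * X.ofBase z := rfl

theorem val_spencerPre {m : ℕ} (ω : X.Form m) (t : A ⊗[k] A) :
    (X.spencerPre ω t).val = X.d ω.val * X.ofBase (LinearMap.mul' k A t) +
      (-1 : ℤ) ^ m • (ω.val * (X.d (X.ofBase (LinearMap.mul' k A t)) - X.univMap t)) := by
  induction t using TensorProduct.induction_on with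
  | zero => simp
  | tmul a b =>
    rw [val_spencerPre_tmul, X.leibniz _ ω.val_mem, LinearMap.mul'_apply, univMap_tmul,
      d_ofBase_mul, map_mul, add_sub_cancel_right, add_mul, smul_mul_assoc]
    simp only [mul_assoc]
  | add s t hs ht =>
    simp only [map_add, hs, ht, mul_add, mul_sub, smul_add, smul_sub]
    abel

/-- For an `m`-form `ω`, the right `A`-linear map `J^1 A → Ω^(m+1)`, `[y ⊗ z] ↦ d(ω y) z`. -/
noncomputable def spencerA {m : ℕ} (ω : X.Form m) : X.J1A →ₗ[Aᵐᵒᵖ] X.Form (m + 1) where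
  __ := J1A.lift X (X.spencerPre ω) (fun t h h' => by ext; rw [val_spencerPre, h, h']; simp)
  map_smul' c t := by
    induction t using J1A.induction_on with
    | zero => simp
    | cls a b =>
      ext
      change X.d (ω.val * X.ofBase a) * X.ofBase (b * c.unop) =
        X.d (ω.val * X.ofBase a) * X.ofBase b * X.ofBase c.unop
      rw [map_mul X.ofBase, mul_assoc]
    | add s t hs ht => simpa [smul_add] using congrArg₂ (· + ·) hs ht

theorem val_spencerA_cls {m : ℕ} (ω : X.Form m) (y z : A) :
    (X.spencerA ω (J1A.cls X y z)).val = X.d (ω.val * X.ofBase y) * X.ofBase z := rfl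

theorem spencerA_add {m : ℕ} (ω η : X.Form m) (t : X.J1A) :
    X.spencerA (ω + η) t = X.spencerA ω t + X.spencerA η t := by
  induction t using J1A.induction_on with
  | zero => simp
  | cls a b => ext; simp [val_spencerA_cls, add_mul]
  | add s t hs ht => simp only [map_add, hs, ht]; abel

theorem spencerA_op_smul {m : ℕ} (ω : X.Form m) (a : A) (t : X.J1A) :
    X.spencerA (MulOpposite.op a • ω) t = X.spencerA ω (a • t) := by
  induction t using J1A.induction_on with
  | zero => simp
  | cls y z => ext; simp [val_spencerA_cls, J1A.smul_cls, mul_assoc]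
  | add s t hs ht => simp only [map_add, smul_add, hs, ht]

/-- The Spencer operator `S^{1,m} : Ω^m J^1 N → Ω^(m+1) N`,
`ω ⊗ [y ⊗ z] ⊗ n ↦ d(ω y) z ⊗ n`. -/
noncomputable def spencer1 (m : ℕ) : X.FormT (X.J1 N) m →+ X.FormT N (m + 1) :=
  Tensor.lift
    (AddMonoidHom.mk' (fun ω => Tensor.mapLeft N (X.spencerA ω)) (fun ω η => by
      ext t
      induction t using Tensor.induction_on with
      | zero => simp
      | tmul t n =>
        simp only [AddMonoidHom.add_apply, Tensor.mapLeft_tmul, spencerA_add, Tensor.add_tmul]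
      | add s t hs ht => simp only [map_add, hs, ht]))
    (fun ω a t => by
      change Tensor.mapLeft N (X.spencerA (MulOpposite.op a • ω)) t =
        Tensor.mapLeft N (X.spencerA ω) (a • t)
      induction t using Tensor.induction_on with
      | zero => simp
      | tmul t n =>
        simp only [Tensor.smul_tmul, Tensor.mapLeft_tmul, spencerA_op_smul]
      | add s t hs ht => simp only [map_add, smul_add, hs, ht])

theorem spencer1_tmul (m : ℕ) (ω : X.Form m) (y z : A) (n : N) :
    X.spencer1 N m (Tensor.tmul A ω (Tensor.tmul A (J1A.cls X y z) n)) =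
      Tensor.tmul A (MulOpposite.op z • Form.diff m (MulOpposite.op y • ω)) n := rfl

/-- `[y ⊗ z] ⊗ n ↦ (d y) z ⊗ n`, as a map `J^1 N → Ω^1 N` (the Spencer operator `S^{1,0}`, which is
minus the usual projection `ρ : J^1 N → Ω^1 N`). -/
noncomputable def sigma : X.J1 N →+ X.FormT N 1 :=
  Tensor.mapLeft N (X.spencerA (1 : X.Form 0))

theorem sigma_cls (y z : A) (n : N) :
    X.sigma N (Tensor.tmul A (J1A.cls X y z) n) =
      Tensor.tmul A (MulOpposite.op z • Form.diffBase X y) n := by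
  change Tensor.tmul A (X.spencerA (1 : X.Form 0) (J1A.cls X y z)) n = _
  congr 1
  ext
  rw [val_spencerA_cls]
  simp

theorem sigma_smul (a : A) (t : X.J1 N) :
    X.sigma N (a • t) = a • X.sigma N t + Tensor.tmul A (Form.diffBase X a) (X.proj10 N t) := by
  induction t using Tensor.induction_on with
  | zero => simp
  | tmul t n =>
    induction t using J1A.induction_on with
    | zero => simp
    | cls y z =>
      rw [Tensor.smul_tmul, J1A.smul_cls, sigma_cls, sigma_cls, proj10_cls, Tensor.smul_tmul,
        ← Tensor.op_smul_tmul, ← Tensor.add_tmul]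
      congr 1
      ext
      rw [map_add, Form.val_op_smul, Form.val_smul, Form.val_op_smul, Form.val_op_smul,
        Form.val_diffBase, Form.val_diffBase, Form.val_diffBase, d_ofBase_mul, MulOpposite.unop_op,
        MulOpposite.unop_op, map_mul X.ofBase, add_mul, mul_assoc, mul_assoc, add_comm]
    | add s t hs ht =>
      rw [Tensor.add_tmul, smul_add, map_add, map_add, map_add, hs, ht, smul_add, Tensor.tmul_add]
      abel
  | add s t hs ht =>
    rw [smul_add, map_add, map_add, map_add, hs, ht, smul_add, Tensor.tmul_add]
    abel

theorem diffBase_algebraMap (r : k) : Form.diffBase X (algebraMap k A r) = 0 := by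
  ext
  rw [Form.val_diffBase, AlgHom.commutes, Algebra.algebraMap_eq_smul_one, map_smul, d_one,
    smul_zero, map_zero]

theorem sigma_smul_algebraMap (r : k) (t : X.J1 N) :
    X.sigma N (algebraMap k A r • t) = algebraMap k A r • X.sigma N t := by
  rw [sigma_smul, diffBase_algebraMap, Tensor.zero_tmul, add_zero]

/-! ### The operator `D̃ : J^1 J^1 N → (Ω^1 ⋉ Ω^2) N` -/

variable {X N} in
theorem wedgeT_add {m p : ℕ} (ω η : X.Form m) (t : X.FormT N p) :
    wedgeT (ω + η) t = wedgeT ω t + wedgeT η t := by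
  induction t using Tensor.induction_on with
  | zero => simp
  | tmul θ n =>
    rw [wedgeT_tmul, wedgeT_tmul, wedgeT_tmul, ← Tensor.add_tmul]
    congr 1
    ext
    simp [add_mul]
  | add s t hs ht => simp only [map_add, hs, ht]; abel

variable {X N} in
theorem wedgeT_op_smul {m p : ℕ} (ω : X.Form m) (a : A) (t : X.FormT N p) :
    wedgeT (MulOpposite.op a • ω) t = wedgeT ω (a • t) := by
  induction t using Tensor.induction_on with
  | zero => simp
  | tmul θ n =>
    rw [Tensor.smul_tmul, wedgeT_tmul, wedgeT_tmul]
    congr 1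
    ext
    simp [mul_assoc]
  | add s t hs ht => simp only [map_add, smul_add, hs, ht]

variable {X N} in
theorem wedgeT_smul {m p : ℕ} (ω : X.Form m) (a : A) (t : X.FormT N p) :
    wedgeT (a • ω) t = a • wedgeT ω t := by
  induction t using Tensor.induction_on with
  | zero => simp
  | tmul θ n =>
    rw [wedgeT_tmul, wedgeT_tmul, Tensor.smul_tmul]
    congr 1
    ext
    simp [mul_assoc]
  | add s t hs ht => simp only [map_add, smul_add, hs, ht]

/-- The left `A`-module `(Ω^1 ⋉ Ω^2) N`: the group `Ω^1 N ⊕ Ω^2 N` with the twisted action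
`a (α, β) = (a α, da ∧ α + a β)`. -/
def SemiForm : Type (max w v) := X.FormT N 1 × X.FormT N 2

noncomputable instance : AddCommGroup (X.SemiForm N) :=
  inferInstanceAs (AddCommGroup (X.FormT N 1 × X.FormT N 2))

variable {X N} in
/-- `d a ∧ α ∈ Ω^2 N` for `a ∈ A` and `α ∈ Ω^1 N`. -/
noncomputable def dWedge (a : A) : X.FormT N 1 →+ X.FormT N 2 :=
  wedgeT (m := 1) (p := 1) (Form.diffBase X a)

variable {X N} in
theorem dWedge_add (a b : A) (t : X.FormT N 1) :
    dWedge (a + b) t = dWedge a t + dWedge b t := by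
  unfold dWedge
  rw [map_add, wedgeT_add]

variable {X N} in
theorem dWedge_mul (a b : A) (t : X.FormT N 1) :
    dWedge (a * b) t = dWedge a (b • t) + a • dWedge b t := by
  unfold dWedge
  rw [← wedgeT_op_smul, ← wedgeT_smul, ← wedgeT_add]
  congr 2
  ext
  exact X.d_ofBase_mul a b

variable {X N} in
theorem dWedge_algebraMap (r : k) (t : X.FormT N 1) : dWedge (algebraMap k A r) t = 0 := by
  unfold dWedge
  rw [diffBase_algebraMap, ← zero_smul A (0 : X.Form 1), wedgeT_smul, zero_smul]

noncomputable instance : Module A (X.SemiForm N) where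
  smul a t := (a • t.1, dWedge a t.1 + a • t.2)
  one_smul t := by
    refine Prod.ext (one_smul A t.1) ?_
    change dWedge 1 t.1 + (1 : A) • t.2 = t.2
    rw [← map_one (algebraMap k A), dWedge_algebraMap, map_one, one_smul, zero_add]
  mul_smul a b t := by
    refine Prod.ext (mul_smul a b t.1) ?_
    change dWedge (a * b) t.1 + (a * b) • t.2 = dWedge a (b • t.1) + a • (dWedge b t.1 + b • t.2)
    rw [dWedge_mul, smul_add, mul_smul, add_assoc]
  smul_zero a := by
    refine Prod.ext (smul_zero a) ?_
    change dWedge a 0 + a • (0 : X.FormT N 2) = 0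
    simp
  smul_add a s t := by
    refine Prod.ext (smul_add a s.1 t.1) ?_
    change dWedge a (s.1 + t.1) + a • (s.2 + t.2) =
      (dWedge a s.1 + a • s.2) + (dWedge a t.1 + a • t.2)
    rw [map_add, smul_add]; abel
  add_smul a b t := by
    refine Prod.ext (add_smul a b t.1) ?_
    change dWedge (a + b) t.1 + (a + b) • t.2 = (dWedge a t.1 + a • t.2) + (dWedge b t.1 + b • t.2)
    rw [dWedge_add, add_smul]; abel
  zero_smul t := by
    refine Prod.ext (zero_smul A t.1) ?_
    change dWedge 0 t.1 + (0 : A) • t.2 = 0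
    rw [← map_zero (algebraMap k A), dWedge_algebraMap, map_zero, zero_smul, zero_add]

theorem univMap_mem (t : A ⊗[k] A) : X.univMap t ∈ X.deg 1 := by
  induction t using TensorProduct.induction_on with
  | zero => rw [map_zero]; exact zero_mem _
  | tmul a b =>
    have h := X.mul_mem (X.ofBase_mem a) (X.d_mem (X.ofBase_mem b))
    simpa using h
  | add s t hs ht => rw [map_add]; exact add_mem hs ht

/-- `a ⊗ b ↦ a (d b)` as a map into `Ω^1`. -/
noncomputable def univForm : A ⊗[k] A →+ X.Form 1 :=
  AddMonoidHom.mk' (fun t => Form.mk (X.univMap t) (X.univMap_mem t)) (fun s t => by ext; simp)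

variable {N} in
/-- For `ξ ∈ J^1 N`, the map `A ⊗_k A → Ω^1 N`, `a ⊗ b ↦ a sigma(b ξ)`. -/
noncomputable def dTildePreI (ξ : X.J1 N) : A ⊗[k] A →+ X.FormT N 1 :=
  TensorProduct.liftAddHom
    (AddMonoidHom.mk' (fun a => AddMonoidHom.mk' (fun b => a • X.sigma N (b • ξ))
        (fun b b' => by simp only [add_smul, map_add, smul_add]))
      (fun a a' => by ext b; simp [add_smul]))
    (fun r a b => by
      change (r • a) • X.sigma N (b • ξ) = a • X.sigma N ((r • b) • ξ)
      rw [Algebra.smul_def r b, mul_smul, sigma_smul_algebraMap, ← mul_smul, Algebra.smul_def,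
        Algebra.commutes])

variable {N} in
theorem dTildePreI_tmul (ξ : X.J1 N) (a b : A) :
    X.dTildePreI ξ (a ⊗ₜ b) = a • X.sigma N (b • ξ) := rfl

variable {N} in
theorem dTildePreI_eq (ξ : X.J1 N) (t : A ⊗[k] A) :
    X.dTildePreI ξ t = Tensor.tmul A (X.univForm t) (X.proj10 N ξ) +
      LinearMap.mul' k A t • X.sigma N ξ := by
  induction t using TensorProduct.induction_on with
  | zero => simp
  | tmul a b =>
    rw [dTildePreI_tmul, sigma_smul, smul_add, ← mul_smul, Tensor.smul_tmul, add_comm]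
    rfl
  | add s t hs ht => simp only [map_add, hs, ht, Tensor.add_tmul, add_smul]; abel

variable {N} in
/-- For `ξ ∈ J^1 N`, the map `A ⊗_k A → Ω^2 N`, `a ⊗ b ↦ da ∧ sigma(b ξ)`. -/
noncomputable def dTildePreII (ξ : X.J1 N) : A ⊗[k] A →+ X.FormT N 2 :=
  TensorProduct.liftAddHom
    (AddMonoidHom.mk' (fun a => AddMonoidHom.mk' (fun b => dWedge a (X.sigma N (b • ξ)))
        (fun b b' => by simp only [add_smul, map_add]))
      (fun a a' => by ext b; simp [dWedge_add]))
    (fun r a b => by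
      change dWedge (r • a) (X.sigma N (b • ξ)) = dWedge a (X.sigma N ((r • b) • ξ))
      rw [Algebra.smul_def r b, mul_smul, sigma_smul_algebraMap, Algebra.smul_def,
        Algebra.commutes, dWedge_mul, dWedge_algebraMap, smul_zero, add_zero])

variable {N} in
theorem dTildePreII_tmul (ξ : X.J1 N) (a b : A) :
    X.dTildePreII ξ (a ⊗ₜ b) = dWedge a (X.sigma N (b • ξ)) := rfl

variable {N} in
theorem dTildePreII_eq (ξ : X.J1 N) (t : A ⊗[k] A) :
    X.dTildePreII ξ t = Tensor.tmul A (Form.diff 1 (X.univForm t)) (X.proj10 N ξ) +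
      (dWedge (LinearMap.mul' k A t) (X.sigma N ξ) -
        wedgeT (m := 1) (p := 1) (X.univForm t) (X.sigma N ξ)) := by
  induction t using TensorProduct.induction_on with
  | zero =>
    have h : wedgeT (m := 1) (p := 1) (0 : X.Form 1) (X.sigma N ξ) = 0 := by
      rw [← zero_smul A (0 : X.Form 1), wedgeT_smul, zero_smul]
    have h' : dWedge (0 : A) (X.sigma N ξ) = 0 := by
      rw [← map_zero (algebraMap k A), dWedge_algebraMap]
    simp only [map_zero, h', Tensor.zero_tmul]
    rw [h]
    simp
  | tmul a b =>
    have h1 : X.univForm (a ⊗ₜ b) = a • Form.diffBase X b := rfl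
    have h2 : Form.diff 1 (a • Form.diffBase X b) =
        (Form.diffBase X a).wedge (Form.diffBase X b) := by
      ext
      simp [X.leibniz _ (X.ofBase_mem a), X.d_d, Form.val_wedge (p := 1)]
    rw [dTildePreII_tmul, sigma_smul, map_add, LinearMap.mul'_apply, dWedge_mul, h1, wedgeT_smul,
      h2]
    change _ + wedgeT (m := 1) (p := 1) _ (Tensor.tmul A _ _) = _
    rw [wedgeT_tmul]
    change _ = _ + (dWedge a (b • X.sigma N ξ) + a • dWedge b (X.sigma N ξ) -
      a • dWedge b (X.sigma N ξ))
    rw [add_sub_cancel_right, add_comm]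
  | add s t hs ht =>
    simp only [map_add, hs, ht, Tensor.add_tmul, dWedge_add, wedgeT_add]
    abel

/-- The first component of `D̃`: `[a ⊗ b] ⊗ ξ ↦ a sigma(b ξ)`, that is
`[a ⊗ b] ⊗ [c ⊗ c'] ⊗ n ↦ a d(b c) c' ⊗ n`. -/
noncomputable def dTildeI : X.J1 (X.J1 N) →+ X.FormT N 1 :=
  Tensor.lift
    (AddMonoidHom.mk' (fun t => AddMonoidHom.mk' (fun ξ => J1A.lift X (X.dTildePreI ξ)
          (fun t h h' => by
            have h0 : X.univForm t = 0 := by ext; exact h'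
            rw [dTildePreI_eq, h, h0]; simp) t)
        (fun ξ η => by
          induction t using J1A.induction_on with
          | zero => simp
          | cls a b => simp [dTildePreI_tmul]
          | add s t hs ht => simp only [map_add, hs, ht]; abel))
      (fun s t => by ext ξ; simp))
    (fun t c ξ => by
      induction t using J1A.induction_on with
      | zero => simp
      | cls a b =>
        change a • X.sigma N ((b * c) • ξ) = a • X.sigma N (b • c • ξ)
        rw [mul_smul]
      | add s t hs ht => simpa [smul_add] using congrArg₂ (· + ·) hs ht)

theorem dTildeI_cls (a b : A) (ξ : X.J1 N) :
    X.dTildeI N (Tensor.tmul A (J1A.cls X a b) ξ) = a • X.sigma N (b • ξ) := rfl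

/-- The second component `D̃^II` of `D̃`: `[a ⊗ b] ⊗ ξ ↦ da ∧ sigma(b ξ)`, that is
`[a ⊗ b] ⊗ [c ⊗ c'] ⊗ n ↦ da ∧ d(b c) c' ⊗ n`. -/
noncomputable def dTildeII : X.J1 (X.J1 N) →+ X.FormT N 2 :=
  Tensor.lift
    (AddMonoidHom.mk' (fun t => AddMonoidHom.mk' (fun ξ => J1A.lift X (X.dTildePreII ξ)
          (fun t h h' => by
            have h0 : X.univForm t = 0 := by ext; exact h'
            have h1 : wedgeT (m := 1) (p := 1) (0 : X.Form 1) (X.sigma N ξ) = 0 := by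
              rw [← zero_smul A (0 : X.Form 1), wedgeT_smul, zero_smul]
            have h2 : dWedge (0 : A) (X.sigma N ξ) = 0 := by
              rw [← map_zero (algebraMap k A), dWedge_algebraMap]
            rw [dTildePreII_eq, h, h0, h1, h2, map_zero, Tensor.zero_tmul, sub_zero, add_zero]) t)
        (fun ξ η => by
          induction t using J1A.induction_on with
          | zero => simp
          | cls a b => simp [dTildePreII_tmul]
          | add s t hs ht => simp only [map_add, hs, ht]; abel))
      (fun s t => by ext ξ; simp))
    (fun t c ξ => by
      induction t using J1A.induction_on with
      | zero => simp
      | cls a b =>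
        change dWedge a (X.sigma N ((b * c) • ξ)) = dWedge a (X.sigma N (b • c • ξ))
        rw [mul_smul]
      | add s t hs ht => simpa [smul_add] using congrArg₂ (· + ·) hs ht)

theorem dTildeII_cls (a b : A) (ξ : X.J1 N) :
    X.dTildeII N (Tensor.tmul A (J1A.cls X a b) ξ) = dWedge a (X.sigma N (b • ξ)) := rfl

/-- The left `A`-linear map `D̃ = (D̃^I, D̃^II) : J^1 J^1 N → (Ω^1 ⋉ Ω^2) N`. -/
noncomputable def dTilde : X.J1 (X.J1 N) →ₗ[A] X.SemiForm N where
  toFun t := (X.dTildeI N t, X.dTildeII N t)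
  map_add' s t := Prod.ext (map_add _ s t) (map_add _ s t)
  map_smul' c t := by
    change (X.dTildeI N (c • t), X.dTildeII N (c • t)) =
      (c • X.dTildeI N t, dWedge c (X.dTildeI N t) + c • X.dTildeII N t)
    induction t using Tensor.induction_on with
    | zero => simp
    | tmul t ξ =>
      induction t using J1A.induction_on with
      | zero => simp
      | cls a b =>
        rw [Tensor.smul_tmul, J1A.smul_cls, dTildeI_cls, dTildeI_cls, dTildeII_cls, dTildeII_cls,
          mul_smul, dWedge_mul]
      | add s t hs ht =>
        obtain ⟨hs1, hs2⟩ := Prod.ext_iff.1 hs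
        obtain ⟨ht1, ht2⟩ := Prod.ext_iff.1 ht
        dsimp only at hs1 hs2 ht1 ht2
        simp only [Tensor.add_tmul, smul_add, map_add, hs1, hs2, ht1, ht2]
        refine Prod.ext rfl ?_
        dsimp only
        abel
    | add s t hs ht =>
      obtain ⟨hs1, hs2⟩ := Prod.ext_iff.1 hs
      obtain ⟨ht1, ht2⟩ := Prod.ext_iff.1 ht
      dsimp only at hs1 hs2 ht1 ht2
      simp only [smul_add, map_add, hs1, hs2, ht1, ht2]
      refine Prod.ext rfl ?_
      dsimp only
      abel

/-! ### Holonomic jets -/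

/-- Two consecutive jet modules `lower = J^n E` and `upper = J^(n+1) E`, with the natural map
`incl = l^{1,n} : J^(n+1) E → J^1 J^n E`. -/
structure JetStage where
  /-- `J^n E` -/
  lower : Type (max u v)
  [groupLower : AddCommGroup lower]
  [moduleLower : Module A lower]
  /-- `J^(n+1) E` -/
  upper : Type (max u v)
  [groupUpper : AddCommGroup upper]
  [moduleUpper : Module A upper]
  /-- `l^{1,n}` -/
  incl : upper →ₗ[A] X.J1 lower

attribute [instance] JetStage.groupLower JetStage.moduleLower JetStage.groupUpper
  JetStage.moduleUpper

variable {X} in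
/-- The passage from `(J^n, J^(n+1), l^{1,n})` to `(J^(n+1), J^(n+2), l^{1,n+1})`: the module
`J^(n+2) E` is the kernel of `D̃ ∘ J^1(l^{1,n}) : J^1 J^(n+1) E → J^1 J^1 J^n E → (Ω^1 ⋉ Ω^2) J^n E`
and `l^{1,n+1}` is its inclusion into `J^1 J^(n+1) E`. -/
noncomputable def JetStage.next (s : JetStage.{u, v} X) : JetStage.{u, v} X where
  lower := s.upper
  upper := LinearMap.ker (X.dTilde s.lower ∘ₗ X.J1map s.incl)
  incl := Submodule.subtype _

variable (E : Type (max u v)) [AddCommGroup E] [Module A E]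

/-- The stages `(J^n E, J^(n+1) E, l^{1,n})`, starting from `J^0 E = E`, `J^1 E = J^1 A ⊗_A E` and
`l^{1,0} = id`. -/
noncomputable def jetStage : ℕ → JetStage.{u, v} X
  | 0 => { lower := E, upper := X.J1 E, incl := LinearMap.id }
  | n + 1 => (jetStage n).next

/-- The holonomic jet module `J^n E`. -/
abbrev Jet (n : ℕ) : Type (max u v) := (jetStage.{u, v} X E n).lower

/-- The natural map `l^{1,n} : J^(n+1) E → J^1 J^n E`. -/
noncomputable def jetIncl (n : ℕ) : Jet.{u, v} X E (n + 1) →ₗ[A] X.J1 (Jet.{u, v} X E n) :=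
  (jetStage.{u, v} X E n).incl

/-- The jet projection `π^{n+1,n} = π^{1,0} ∘ l^{1,n} : J^(n+1) E → J^n E`. -/
noncomputable def jetProj (n : ℕ) : Jet.{u, v} X E (n + 1) →ₗ[A] Jet.{u, v} X E n :=
  X.proj10 (Jet.{u, v} X E n) ∘ₗ jetIncl.{u, v} X E n

/-- The Spencer operator `S^{n+1,m} : Ω^m J^(n+1) E → Ω^(m+1) J^n E`,
`ω ⊗ ∑ [y_j ⊗ z_j] ⊗ ξ_j ↦ ∑ d(ω y_j) z_j ⊗ ξ_j`, where the element `∑ [y_j ⊗ z_j] ⊗ ξ_j` of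
`J^1 J^n E` is the image under `l^{1,n}` of an element of `J^(n+1) E`. -/
noncomputable def spencer (n m : ℕ) :
    X.FormT (Jet.{u, v} X E (n + 1)) m →+ X.FormT (Jet.{u, v} X E n) (m + 1) :=
  (X.spencer1 (Jet.{u, v} X E n) m).comp
    (Tensor.mapRight (X.Form m) (jetIncl.{u, v} X E n)).toAddMonoidHom

/-- The operator `S^{n+1,0}` on `J^(n+1) E`, identified with `Ω^0 J^(n+1) E = A ⊗_A J^(n+1) E`
through `ξ ↦ 1 ⊗ ξ`. -/
noncomputable def spencerZero (n : ℕ) :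
    Jet.{u, v} X E (n + 1) →+ X.FormT (Jet.{u, v} X E n) 1 :=
  (spencer.{u, v} X E n 0).comp (Tensor.tmulHom (1 : X.Form 0))

/-! ### Higher order connections -/

/-- An `(n+1)`-connection on `E`: a left `A`-linear section `C : J^n E → J^(n+1) E` of the jet
projection `π^{n+1,n}`. -/
structure HigherConnection (n : ℕ) where
  /-- the section -/
  map : Jet.{u, v} X E n →ₗ[A] Jet.{u, v} X E (n + 1)
  proj_map : jetProj.{u, v} X E n ∘ₗ map = LinearMap.id

namespace HigherConnection

variable {X E} {n : ℕ} (C : HigherConnection.{u, v} X E n)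

/-- The curvature `R_C = - D̃^II ∘ J^1(l^{1,n}) ∘ J^1(C) ∘ l^{1,n} ∘ C : J^n E → Ω^2 J^n E`. -/
noncomputable def curvature : Jet.{u, v} X E n →+ X.FormT (Jet.{u, v} X E n) 2 :=
  -((X.dTildeII (Jet.{u, v} X E n)).comp
    (X.J1map (jetIncl.{u, v} X E n) ∘ₗ X.J1map C.map ∘ₗ jetIncl.{u, v} X E n ∘ₗ
      C.map).toAddMonoidHom)

/-- The associated connection `∇^C = S^{n+1,0} ∘ C : J^n E → Ω^1 J^n E`. -/
noncomputable def nabla : Jet.{u, v} X E n →+ X.FormT (Jet.{u, v} X E n) 1 :=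
  (spencerZero.{u, v} X E n).comp C.map.toAddMonoidHom

/-- The exterior covariant derivative `d_C = S^{n+1,m} ∘ Ω^m(C) : Ω^m J^n E → Ω^(m+1) J^n E`. -/
noncomputable def extDeriv (m : ℕ) :
    X.FormT (Jet.{u, v} X E n) m →+ X.FormT (Jet.{u, v} X E n) (m + 1) :=
  (spencer.{u, v} X E n m).comp (Tensor.mapRight (X.Form m) C.map).toAddMonoidHom

/-- The curvature `R_∇ = d_C ∘ ∇^C : J^n E → Ω^2 J^n E` of the associated connection. -/
noncomputable def nablaCurvature : Jet.{u, v} X E n →+ X.FormT (Jet.{u, v} X E n) 2 :=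
  (C.extDeriv 1).comp C.nabla

end HigherConnection

end ExteriorCalculus

end NCJet

namespace NCJet

/-! Both assertions involve `C` only through the composite `D = l ∘ C`, an `A`-linear section of
`π^{1,0}` over the module `N` of jets. So they are proved for an arbitrary left module `N` and an
arbitrary `A`-linear section `D : N → J^1 N`, and then specialised.

A one-jet `t` enters the Spencer operator only through its value `π(t)` in `N` and its form part
`σ(t)` in `Ω^1 N`: the Leibniz rule turns `d(ω y) z` into `dω y z + (-1)^m ω ∧ dy z`
(`spencer1_eq`). With `∇ = σ ∘ D` and `π ∘ D = id`, the operator `d_D` therefore has the classical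
form `d_D(ω ⊗ ξ) = dω ⊗ ξ + (-1)^m ω ∧ ∇ξ` (`covDeriv_tmul`), and it obeys a graded Leibniz rule
(`covDeriv_wedgeT`). As usual, applying it twice makes the two terms `dω ∧ ∇ξ` cancel, leaving `ω ∧
d_D ∇ξ` (`covDeriv_covDeriv_tmul`).

It remains to recognise `d_D ∇ξ` as the jet-theoretic curvature. On a generator, `σ([y ⊗ z] ⊗ n) =
dy ⊗ z n`. Since `d(dy) = 0`, applying `d_D` gives `-dy ∧ σ(D(z n))`, and linearity of `D` turns
this into `-D̃^II([y ⊗ z] ⊗ D n)`. Hence `d_D ∘ σ = -D̃^II ∘ J^1(D)` (`covDeriv_sigma`), and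
evaluating at `t = D ξ` gives the curvature. -/

theorem Tensor.add_zsmul_tmul {A : Type u} [Ring A] {M : Type w} [AddCommGroup M] [Module A M]
    [Module Aᵐᵒᵖ M] [SMulCommClass A Aᵐᵒᵖ M] {N : Type v} [AddCommGroup N] [Module A N]
    (a b : M) (r : ℤ) (n : N) :
    Tensor.tmul A (a + r • b) n = Tensor.tmul A a n + r • Tensor.tmul A b n := by
  rw [Tensor.add_tmul]
  -- For fixed `n`, the map `m ↦ m ⊗ n` is a group homomorphism, so it commutes with integer
  -- multiples.
  exact congrArg (_ + ·) (map_zsmul ((Tensor.tmulHom (A := A) (M := M)).flip n) r b)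

namespace ExteriorCalculus

/-! ### Covariant derivatives attached to a linear section of `J^1 N → N` -/

section LinearSection

variable {k : Type x} {A : Type u} {Ω : Type w}
  [CommRing k] [Ring A] [Algebra k A] [Ring Ω] [Algebra k Ω]
variable (X : ExteriorCalculus k A Ω) {N : Type v} [AddCommGroup N] [Module A N]

/-- The Spencer operator in terms of the two natural maps `J^1 N → N` and `J^1 N → Ω^1 N`:
`S(ω ⊗ t) = dω ⊗ π(t) + (-1)^m ω ∧ σ(t)`. -/
theorem spencer1_eq (m : ℕ) (ω : X.Form m) (t : X.J1 N) :
    X.spencer1 N m (Tensor.tmul A ω t) =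
      Tensor.tmul A (Form.diff m ω) (X.proj10 N t) +
        (-1 : ℤ) ^ m • wedgeT (p := 1) ω (X.sigma N t) := by
  induction t using Tensor.induction_on with
  | zero => simp
  | add s t hs ht => simp only [Tensor.tmul_add, map_add, hs, ht, smul_add]; abel
  | tmul t n =>
    induction t using J1A.induction_on with
    | zero => simp
    | add s t hs ht =>
      simp only [Tensor.add_tmul, Tensor.tmul_add, map_add, hs, ht, smul_add]; abel
    | cls y z =>
      -- The scalar `y z` is moved from `n` onto `dω`, so that every term is a pure tensor with the
      -- same right factor `n`. What remains is an identity of forms, namely the Leibniz rule for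
      -- `d(ω y)` multiplied on the right by `z`.
      rw [spencer1_tmul, sigma_cls, proj10_cls, wedgeT_tmul, ← Tensor.op_smul_tmul]
      refine Eq.trans ?_ (Tensor.add_zsmul_tmul (M := X.Form (m + 1)) _ _ _ n)
      congr 1
      ext
      have hw : (ω.wedge (MulOpposite.op z • Form.diffBase X y)).val =
        ω.val * (X.d (X.ofBase y) * X.ofBase z) := rfl
      rw [map_add, map_zsmul, hw]
      simp only [Form.val_op_smul, Form.val_diff, MulOpposite.unop_op, map_mul]
      rw [X.leibniz _ ω.val_mem, add_mul, smul_mul_assoc, mul_assoc, mul_assoc]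

/-- The exterior covariant derivative `Ω^m N → Ω^(m+1) N` attached to a linear map
`D : N → J^1 N`. -/
noncomputable def covDeriv (D : N →ₗ[A] X.J1 N) (m : ℕ) : X.FormT N m →+ X.FormT N (m + 1) :=
  (X.spencer1 N m).comp (Tensor.mapRight (X.Form m) D).toAddMonoidHom

variable {X} {D : N →ₗ[A] X.J1 N}

/-- The section property is what makes the first term of `spencer1_eq` equal to `dω ⊗ ξ`. This
identifies `d_D` as the usual extension to forms of the connection `σ ∘ D`. -/
theorem covDeriv_tmul (hD : ∀ ξ, X.proj10 N (D ξ) = ξ) (m : ℕ) (ω : X.Form m) (ξ : N) :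
    X.covDeriv D m (Tensor.tmul A ω ξ) =
      Tensor.tmul A (Form.diff m ω) ξ + (-1 : ℤ) ^ m • wedgeT (p := 1) ω (X.sigma N (D ξ)) := by
  change X.spencer1 N m (Tensor.tmul A ω (D ξ)) = _
  rw [spencer1_eq, hD]

/-- The graded Leibniz rule `d_D (ω ∧ τ) = dω ∧ τ + (-1)^m ω ∧ d_D τ` for `τ ∈ Ω^1 N`. -/
theorem covDeriv_wedgeT (hD : ∀ ξ, X.proj10 N (D ξ) = ξ) (m : ℕ) (ω : X.Form m)
    (τ : X.FormT N 1) :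
    X.covDeriv D (m + 1) (wedgeT (p := 1) ω τ) =
      wedgeT (m := m + 1) (p := 1) (Form.diff m ω) τ +
        (-1 : ℤ) ^ m • wedgeT (p := 2) ω (X.covDeriv D 1 τ) := by
  induction τ using Tensor.induction_on with
  | zero => simp
  | add s t hs ht => simp only [map_add, hs, ht, smul_add]; abel
  | tmul η ξ =>
    -- Associativity of the wedge product. The degrees `(m + 1) + 1` and `m + 2` agree by
    -- definition, so no cast is needed; since they are not syntactically equal, the auxiliary facts
    -- are combined through `congrArg` and `trans`.
    have hassoc (t : X.FormT N 1) : wedgeT (m := m + 1) (p := 1) (ω.wedge η) t =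
        wedgeT (p := 2) ω (wedgeT (m := 1) (p := 1) η t) := by
      induction t using Tensor.induction_on with
      | zero => simp
      | add s t hs ht =>
        rw [map_add, map_add, hs, ht]
        exact (map_add (wedgeT (p := 2) ω) _ _).symm
      | tmul θ n =>
        change Tensor.tmul A _ n = Tensor.tmul A _ n
        congr 1
        exact Form.ext (mul_assoc _ _ _)
    have hdiff : Form.diff (m + 1) (ω.wedge η) =
        (Form.diff m ω).wedge η + (-1 : ℤ) ^ m • (ω.wedge (Form.diff 1 η) : X.Form (m + 2)) := by
      apply Form.ext
      rw [map_add, map_zsmul]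
      exact X.leibniz _ ω.val_mem
    have hlin (a b : X.FormT N 2) (r : ℤ) : wedgeT (p := 2) ω (a + r • b) =
        wedgeT (p := 2) ω a + r • wedgeT (p := 2) ω b := by
      rw [map_add, map_zsmul]
    have hdω : wedgeT (m := m + 1) (p := 1) (Form.diff m ω) (Tensor.tmul A η ξ) =
      Tensor.tmul A ((Form.diff m ω).wedge η) ξ := rfl
    have hdη : wedgeT (p := 2) ω (Tensor.tmul A (Form.diff 1 η) ξ) =
      Tensor.tmul A (ω.wedge (Form.diff 1 η)) ξ := rfl
    rw [wedgeT_tmul, covDeriv_tmul hD (m + 1), covDeriv_tmul hD 1]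
    refine (congrArg₂ (· + ·)
      ((congrArg (Tensor.tmul A · ξ) hdiff).trans (Tensor.add_zsmul_tmul _ _ _ ξ))
      (congrArg _ (hassoc _))).trans ?_
    -- The sign `(-1) ^ 1` is the one in `d_D(η ⊗ ξ)` for the one-form `η`. Multiplied by `(-1) ^
    -- m`, it matches the sign `(-1) ^ (m + 1)` produced by the form `ω ∧ η` of degree `m + 1`.
    have hright := hlin (Tensor.tmul A (Form.diff 1 η) ξ)
      (wedgeT (m := 1) (p := 1) η (X.sigma N (D ξ))) ((-1) ^ 1)
    rw [hdη] at hright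
    refine Eq.trans ?_ (congrArg₂ (· + ·) hdω.symm (congrArg ((-1 : ℤ) ^ m • ·) hright.symm))
    rw [smul_add, ← add_assoc, smul_smul, pow_succ, pow_one]

/-- The bridge between the two notions of curvature. The minus sign is that of `d_D` on one-forms,
and it accounts for the sign in the definition of the jet curvature. -/
theorem covDeriv_sigma (hD : ∀ ξ, X.proj10 N (D ξ) = ξ) (t : X.J1 N) :
    X.covDeriv D 1 (X.sigma N t) = -X.dTildeII N (X.J1map D t) := by
  induction t using Tensor.induction_on with
  | zero => simp
  | add s t hs ht => simp only [map_add, hs, ht, neg_add]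
  | tmul t n =>
    induction t using J1A.induction_on with
    | zero => simp
    | add s t hs ht => simp only [Tensor.add_tmul, map_add, hs, ht, neg_add]
    | cls y z =>
      have hd : Form.diff 1 (Form.diffBase X y) = 0 := Form.ext (by simp [X.d_d])
      -- The factor `z` is moved onto `n` so that the form part `dy` is closed; `map_smul` then
      -- extracts `z` from `D (z • n)`, which is where linearity of `D` enters.
      rw [sigma_cls, Tensor.op_smul_tmul, covDeriv_tmul hD, hd, Tensor.zero_tmul, zero_add,
        pow_one, neg_one_zsmul, map_smul]
      rfl

theorem covDeriv_covDeriv_tmul (hD : ∀ ξ, X.proj10 N (D ξ) = ξ) (m : ℕ) (ω : X.Form m)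
    (ξ : N) :
    X.covDeriv D (m + 1) (X.covDeriv D m (Tensor.tmul A ω ξ)) =
      wedgeT (p := 2) ω (X.covDeriv D 1 (X.sigma N (D ξ))) := by
  have hd : Form.diff (m + 1) (Form.diff m ω) = 0 := Form.ext (by simp [X.d_d])
  -- The term `dω ∧ ∇ξ` occurs with sign `(-1)^(m+1)` from `d_D(dω ⊗ ξ)` and with sign `(-1)^m` from
  -- the Leibniz rule, so it cancels. The surviving term has sign `(-1)^m (-1)^m = 1`.
  rw [covDeriv_tmul hD m, map_add, map_zsmul, covDeriv_tmul hD (m + 1), hd, Tensor.zero_tmul,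
    zero_add, covDeriv_wedgeT hD, smul_add, smul_smul, ← mul_pow, neg_one_mul, neg_neg, one_pow,
    one_smul, pow_succ, mul_neg_one, neg_smul, neg_add_cancel_left]

end LinearSection

/-! ### Specialisation to higher order connections -/

namespace HigherConnection

variable {k : Type x} {A : Type u} {Ω : Type w}
  [CommRing k] [Ring A] [Algebra k A] [Ring Ω] [Algebra k Ω]
variable {X : ExteriorCalculus k A Ω} {E : Type (max u v)} [AddCommGroup E] [Module A E]
variable {n : ℕ} (C : HigherConnection.{u, v} X E n)

/-- The linear section `l^{1,n} ∘ C : J^n E → J^1 J^n E` of `π^{1,0}`. -/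
noncomputable def toJ1 : Jet.{u, v} X E n →ₗ[A] X.J1 (Jet.{u, v} X E n) :=
  jetIncl.{u, v} X E n ∘ₗ C.map

theorem proj10_toJ1 (ξ : Jet.{u, v} X E n) : X.proj10 _ (C.toJ1 ξ) = ξ :=
  LinearMap.congr_fun C.proj_map ξ

theorem extDeriv_eq (m : ℕ) : C.extDeriv m = X.covDeriv C.toJ1 m := by
  ext t
  induction t using Tensor.induction_on with
  | zero => rw [map_zero, map_zero]
  | add s t hs ht => rw [map_add, map_add, hs, ht]
  | tmul ω ξ => rfl

/-- Definitional, because `sigma` is the Spencer operator evaluated at the zero-form `1`, and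
`spencerZero` inserts that same `1`. -/
theorem nabla_apply (ξ : Jet.{u, v} X E n) : C.nabla ξ = X.sigma _ (C.toJ1 ξ) := rfl

theorem curvature_apply (ξ : Jet.{u, v} X E n) :
    C.curvature ξ = -X.dTildeII _ (X.J1map C.toJ1 (C.toJ1 ξ)) := by
  -- Functoriality of `J^1`, checked on generators: it merges the two maps `J^1(l)` and `J^1(C)`
  -- into `J^1` of the single section `l ∘ C`.
  have h (t : X.J1 (Jet.{u, v} X E n)) :
      X.J1map (jetIncl.{u, v} X E n) (X.J1map C.map t) = X.J1map C.toJ1 t := by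
    induction t using Tensor.induction_on with
    | zero => simp only [map_zero]
    | add s t hs ht => simp only [map_add, hs, ht]
    | tmul t ξ => rfl
  rw [← h]
  rfl

/-- This is `covDeriv_sigma` at the one-jet `t = D ξ`, where `σ(D ξ) = ∇ξ`. -/
theorem curvature_eq_nablaCurvature : C.curvature = C.nablaCurvature := by
  ext ξ
  rw [curvature_apply, ← covDeriv_sigma C.proj10_toJ1, ← nabla_apply, ← extDeriv_eq]
  rfl

end HigherConnection

end ExteriorCalculus

end NCJet

/-- The index `n` is one less than the order of the connection, so letting it range over all natural
numbers covers every order at least one. -/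
theorem proposition4p14 {k : Type x} {A : Type u} {Ω : Type w}
    [CommRing k] [Ring A] [Algebra k A] [Ring Ω] [Algebra k Ω]
    (X : NCJet.ExteriorCalculus k A Ω)
    (E : Type (max u v)) [AddCommGroup E] [Module A E]
    (n : ℕ) (C : NCJet.ExteriorCalculus.HigherConnection.{u, v} X E n) :
    C.curvature = C.nablaCurvature ∧
    ∀ (m : ℕ) (ω : X.Form m) (ξ : NCJet.ExteriorCalculus.Jet.{u, v} X E n),
      C.extDeriv (m + 1) (C.extDeriv m (NCJet.Tensor.tmul A ω ξ)) =
        NCJet.ExteriorCalculus.wedgeT ω (C.curvature ξ) := by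
  refine ⟨C.curvature_eq_nablaCurvature, fun m ω ξ => ?_⟩
  rw [C.extDeriv_eq, C.extDeriv_eq,
    NCJet.ExteriorCalculus.covDeriv_covDeriv_tmul C.proj10_toJ1, C.curvature_apply,
    ← NCJet.ExteriorCalculus.covDeriv_sigma C.proj10_toJ1]
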